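/- For $k\ge 1$, let $\Delta_k$ be the set of probability distributions on $[k]=\{1,\dots,k\}$, and for $q,p\in\Delta_k$ let $\mathrm{KL}(q\,\|\,p)=\sum_{i=1}^k q(i)\ln\frac{q(i)}{p(i)}\in[0,\infty]$ be the Kullback--Leibler divergence. A (possibly randomized) estimator with $n$ samples receives $n$ independent samples from an unknown $p\in\Delta_k$ and outputs $\hat p\in\Delta_k$; it learns to accuracy $\varepsilon>0$ with error probability $\delta\in(0,1]$ if, for every $p\in\Delta_k$, $\Pr[\mathrm{KL}(\hat p\,\|\,p)>\varepsilon]\le\delta$. Let $\Phi(\mathrm{KL},k,\varepsilon,\delta)$ be the least $n$ for which such an estimator exists. **Theorem.** $\Phi(\mathrm{KL},k,\varepsilon,\delta)=\Theta\!\left(\frac{k+\log(1/\delta)}{\varepsilon}\right)$, and the upper bound is achieved by the empirical distribution. That is, there are absolute constants $c,C,\varepsilon_0,\delta_0>0$ such that 1. for all $k\ge 2$, $0<\varepsilon\le\varepsilon_0$ and $0<\delta\le\delta_0$: $\ \Phi(\mathrm{KL},k,\varepsilon,\delta)\ge c\,\frac{k+\ln(1/\delta)}{\varepsilon}$; 2.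 for all $k\ge 1$, $0<\varepsilon\le 1$ and $0<\delta\le 1$: $\ \Phi(\mathrm{KL},k,\varepsilon,\delta)\le C\,\frac{k+\ln(1/\delta)}{\varepsilon}$; 3. for all $k\ge 1$, $\varepsilon>0$, $0<\delta\le 1$ and every integer $n\ge C\,\frac{k+\ln(1/\delta)}{\varepsilon}$, the empirical estimator $\hat p(i)=\frac1n\#\{j: s_j=i\}$ of $n$ samples $s_1,\dots,s_n$ learns to accuracy $\varepsilon$ with error probability $\delta$. -/

import Mathlib

open MeasureTheory ProbabilityTheory InformationTheory
open scoped ENNReal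

/-- The probability distributions over the known domain `[k]`. -/
abbrev Distr (k : ℕ) : Type := ProbabilityMeasure (Fin k)

/-- A (possibly randomized) estimator for distributions over `[k]` from `n` samples: a Markov kernel
that maps the observed sample `s₁, …, sₙ` to the law of the output distribution. -/
structure Estimator (k n : ℕ) where
  toKernel : Kernel (Fin n → Fin k) (Distr k)
  isMarkov : IsMarkovKernel toKernel

/-- The law of the output of the estimator `A` when its input consists of `n` independent samples
from `p`. -/
noncomputable def Estimator.outputLaw {k n : ℕ} (A : Estimator k n) (p : Distr k) :
    Measure (Distr k) :=
  (Measure.pi fun _ : Fin n => (p : Measure (Fin k))).bind A.toKernel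

/-- The estimator `A` learns every distribution over `[k]` to accuracy `ε` with respect to `d`, with
error probability at most `δ`. The first argument of `d` is the output of the estimator, the second
one is the unknown distribution `p`. -/
def Estimator.Learns {k n : ℕ} (d : Distr k → Distr k → ℝ≥0∞) (A : Estimator k n) (ε δ : ℝ) :
    Prop :=
  ∀ p : Distr k,
    A.outputLaw p {q | ENNReal.ofReal ε < d q p} ≤ ENNReal.ofReal δ

/-- The sample complexity of learning distributions over `[k]` with respect to `d`: the least number
of samples from which some estimator learns to accuracy `ε` with error probability `δ`
(and `⊤` if there is none). -/
noncomputable def sampleComplexity {k : ℕ} (d : Distr k → Distr k → ℝ≥0∞) (ε δ : ℝ) : ℕ∞ :=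
  ⨅ (n : ℕ) (_ : ∃ A : Estimator k n, A.Learns d ε δ), (n : ℕ∞)

/-- The Kullback-Leibler divergence `KL(q ‖ p) = ∑ i, q i * log (q i / p i)`, with values
in `[0, ∞]`. -/
noncomputable def klLoss {k : ℕ} (q p : Distr k) : ℝ≥0∞ :=
  klDiv (q : Measure (Fin k)) (p : Measure (Fin k))

/-- The empirical distribution `i ↦ (1 / n) * #{j | s j = i}` of a sample of size `n ≥ 1`. -/
noncomputable def empiricalDistr {k n : ℕ} [NeZero n] (s : Fin n → Fin k) : Distr k :=
  ⟨(n : ℝ≥0∞)⁻¹ • ∑ j : Fin n, Measure.dirac (s j), ⟨by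
    simp [ENNReal.inv_mul_cancel (Nat.cast_ne_zero.mpr (NeZero.ne n)) (ENNReal.natCast_ne_top n)]⟩⟩

/-- The (deterministic) estimator that outputs the empirical distribution of its sample. -/
noncomputable def empiricalEstimator (k n : ℕ) [NeZero n] : Estimator k n where
  toKernel := Kernel.deterministic empiricalDistr Measurable.of_discrete
  isMarkov := inferInstance

/-!
Upper bound. For a sample `s` of size `n` with empirical distribution `q`, the number
`exp (n * KL(q ‖ p))` is the ratio of the likelihoods of `s` under `q` and under `p`, so the
expectation of `exp (n * KL(q ‖ p) / 2)` is a multinomial sum of square roots of likelihoods.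
Splitting off one letter at a time reduces it to `k` binomial sums; by a Chernoff bound the terms of
such a sum are dominated by increments of the square root of the binomial tail, so it telescopes and
costs a constant factor. Hence the expectation is at most `4 ^ k`, and Markov's inequality
concludes.

Lower bound. Divide the letters into `m = ⌊k / 2⌋` pairs and bias every pair by `η` of order `√ε`
towards one of its letters, as prescribed by a vertex of the cube `{0, 1} ^ m`. Since `KL` dominates
the squared Hellinger distance, an accurate output reveals all but a small fraction of the
coordinates of the vertex. The Hellinger affinity is multiplicative over samples and controls the
error of every test. For two opposite vertices it is `√(1 - η ^ 2)` per sample, which forces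
`log (1 / δ) ≲ n * ε` by Le Cam's method; for two adjacent ones it is at least `1 - η ^ 2 / m`,
which forces `m ≲ n * ε` by Assouad's.
-/

open Finset.HasAntidiagonal (antidiagonal mem_antidiagonal)

/-! ### Binomial sums -/

/-- The part `∑ j ≥ m` of the binomial expansion of `(a + b) ^ n`; for `a + b = 1` it is the
probability of at least `m` successes in `n` trials. -/
noncomputable def binomialTail (a b : ℝ) (n m : ℕ) : ℝ :=
  ∑ j ∈ Finset.Ico m (n + 1), (n.choose j : ℝ) * (a ^ j * b ^ (n - j))

/-- For `a + b = 1` and `n = m + l`, this is `√(n ^ n)` times the contribution of the outcome with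
`m` successes and `l` failures to the expectation of `exp (n * KL / 2)`, where `KL` is the
divergence of the empirical distribution of `n` trials from `(a, b)`. -/
noncomputable def klMomentTerm (a b : ℝ) (m l : ℕ) : ℝ :=
  ((m + l).choose m : ℝ) * √(a ^ m * b ^ l * ((m : ℝ) ^ m * (l : ℝ) ^ l))

lemma binomialTail_zero (a b : ℝ) (n : ℕ) : binomialTail a b n 0 = (a + b) ^ n := by
  rw [binomialTail, ← Finset.range_eq_Ico, add_pow]
  exact Finset.sum_congr rfl fun _ _ => mul_comm _ _

lemma binomialTail_eq_add_succ (a b : ℝ) (m l : ℕ) :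
    binomialTail a b (m + l) m =
      (m + l).choose m * (a ^ m * b ^ l) + binomialTail a b (m + l) (m + 1) := by
  rw [binomialTail, binomialTail, Finset.sum_eq_sum_Ico_succ_bot (by omega),
    Nat.add_sub_cancel_left]

lemma klMomentTerm_comm (a b : ℝ) (m l : ℕ) : klMomentTerm a b m l = klMomentTerm b a l m := by
  rw [klMomentTerm, klMomentTerm, Nat.choose_symm_add, add_comm m l]
  congr 2
  ring

lemma div_sqrt_le_two_mul_sqrt_sub_sqrt {s t : ℝ} (hs : 0 ≤ s) (hst : s ≤ t) :
    (t - s) / √t ≤ 2 * (√t - √s) := by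
  refine div_le_of_le_mul₀ (Real.sqrt_nonneg t) (by linarith [Real.sqrt_le_sqrt hst]) ?_
  nlinarith [Real.sq_sqrt hs, Real.sq_sqrt (hs.trans hst), sq_nonneg (√t - √s)]

section Binomial

variable {a b : ℝ} (ha : 0 ≤ a) (hb : 0 ≤ b)
include ha hb

lemma binomialTail_nonneg (n m : ℕ) : 0 ≤ binomialTail a b n m :=
  Finset.sum_nonneg fun _ _ => by positivity

lemma binomialTail_succ_le (m l : ℕ) :
    binomialTail a b (m + l) (m + 1) ≤ binomialTail a b (m + l) m := by
  rw [binomialTail_eq_add_succ]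
  exact le_add_of_nonneg_left (by positivity)

/-- A Chernoff bound: tilting the weights from `(a, b)` to `(m, l)` only increases the terms beyond
`m`, up to a common factor. -/
lemma binomialTail_mul_le {m l : ℕ} (h : l * a ≤ m * b) :
    binomialTail a b (m + l) m * ((m : ℝ) ^ m * (l : ℝ) ^ l) ≤
      a ^ m * b ^ l * ((m + l : ℕ) : ℝ) ^ (m + l) := by
  have tilt : ∀ j ∈ Finset.Ico m (m + l + 1),
      ((m + l).choose j : ℝ) * (a ^ j * b ^ (m + l - j)) * ((m : ℝ) ^ m * (l : ℝ) ^ l) ≤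
        a ^ m * b ^ l * (((m + l).choose j : ℝ) * ((m : ℝ) ^ j * (l : ℝ) ^ (m + l - j))) := by
    intro j hj
    obtain ⟨d, rfl⟩ := Nat.exists_eq_add_of_le (Finset.mem_Ico.mp hj).1
    obtain ⟨e, rfl⟩ : ∃ e, l = d + e :=
      Nat.exists_eq_add_of_le (by have := (Finset.mem_Ico.mp hj).2; omega)
    rw [show m + (d + e) - (m + d) = e by omega]
    calc ((m + (d + e)).choose (m + d) : ℝ) * (a ^ (m + d) * b ^ e) *
          ((m : ℝ) ^ m * ((d + e : ℕ) : ℝ) ^ (d + e))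
        = (m + (d + e)).choose (m + d) * a ^ m * b ^ e * m ^ m * ((d + e : ℕ) : ℝ) ^ e *
            (((d + e : ℕ) : ℝ) * a) ^ d := by ring
      _ ≤ (m + (d + e)).choose (m + d) * a ^ m * b ^ e * m ^ m * ((d + e : ℕ) : ℝ) ^ e *
            (m * b) ^ d := by gcongr
      _ = a ^ m * b ^ (d + e) * (((m + (d + e)).choose (m + d) : ℝ) *
            ((m : ℝ) ^ (m + d) * ((d + e : ℕ) : ℝ) ^ e)) := by ring
  calc binomialTail a b (m + l) m * ((m : ℝ) ^ m * (l : ℝ) ^ l)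
      ≤ a ^ m * b ^ l * binomialTail m l (m + l) m := by
        rw [binomialTail, binomialTail, Finset.sum_mul, Finset.mul_sum]
        exact Finset.sum_le_sum tilt
    _ ≤ a ^ m * b ^ l * binomialTail m l (m + l) 0 := by
        gcongr
        exact Finset.sum_le_sum_of_subset_of_nonneg (Finset.Ico_subset_Ico_left (Nat.zero_le m))
          fun _ _ _ => by positivity
    _ = a ^ m * b ^ l * ((m + l : ℕ) : ℝ) ^ (m + l) := by rw [binomialTail_zero, Nat.cast_add]

/-- With `T j` the tail beyond `j`, the Chernoff bound turns the moment term into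
`(T m - T (m + 1)) / √(T m)`, which telescopes up to a factor `2`. -/
lemma klMomentTerm_le_sqrt_sub_sqrt {m l : ℕ} (h : l * a ≤ m * b) :
    klMomentTerm a b m l ≤ √(((m + l : ℕ) : ℝ) ^ (m + l)) *
      (2 * (√(binomialTail a b (m + l) m) - √(binomialTail a b (m + l) (m + 1)))) := by
  have chernoff := binomialTail_mul_le ha hb h
  have term_eq : binomialTail a b (m + l) m - binomialTail a b (m + l) (m + 1) =
      (m + l).choose m * (a ^ m * b ^ l) := by rw [binomialTail_eq_add_succ]; ring
  have tail_nonneg := binomialTail_nonneg ha hb (m + l) (m + 1)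
  have tail_le := binomialTail_succ_le ha hb m l
  refine le_trans ?_ (mul_le_mul_of_nonneg_left
    (div_sqrt_le_two_mul_sqrt_sub_sqrt tail_nonneg tail_le) (Real.sqrt_nonneg _))
  rw [term_eq]
  set q := a ^ m * b ^ l
  set M := (m : ℝ) ^ m * (l : ℝ) ^ l
  set T := binomialTail a b (m + l) m
  have hq : 0 ≤ q := by positivity
  rcases hq.eq_or_lt with hq0 | hq0
  · rw [← hq0, klMomentTerm, show a ^ m * b ^ l = 0 from hq0.symm]
    simp
  have choose_pos : 0 < ((m + l).choose m : ℝ) := by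
    exact_mod_cast Nat.choose_pos (Nat.le_add_right m l)
  have hT : 0 < T := by linarith [mul_pos choose_pos hq0]
  rw [mul_div_assoc', le_div_iff₀ (Real.sqrt_pos.mpr hT)]
  have sqrt_le : √(q * M) * √T ≤ √(((m + l : ℕ) : ℝ) ^ (m + l)) * q := by
    rw [← Real.sqrt_mul (by positivity), ← Real.sqrt_sq hq, ← Real.sqrt_mul (by positivity),
      Real.sqrt_sq hq]
    refine Real.sqrt_le_sqrt ?_
    calc q * M * T = q * (T * M) := by ring
      _ ≤ q * (q * ((m + l : ℕ) : ℝ) ^ (m + l)) := by gcongr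
      _ = ((m + l : ℕ) : ℝ) ^ (m + l) * q ^ 2 := by ring
  calc klMomentTerm a b m l * √T = (m + l).choose m * (√(q * M) * √T) := by
        rw [klMomentTerm, mul_assoc]
    _ ≤ (m + l).choose m * (√(((m + l : ℕ) : ℝ) ^ (m + l)) * q) := by gcongr
    _ = √(((m + l : ℕ) : ℝ) ^ (m + l)) * ((m + l).choose m * q) := by ring

lemma sum_filter_klMomentTerm_le (n : ℕ) :
    ∑ x ∈ antidiagonal n with x.2 * a ≤ x.1 * b, klMomentTerm a b x.1 x.2 ≤
      2 * √((n : ℝ) ^ n * (a + b) ^ n) := by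
  let g : ℕ × ℕ → ℝ := fun x =>
    √((n : ℝ) ^ n) * (2 * (√(binomialTail a b n x.1) - √(binomialTail a b n (x.1 + 1))))
  calc ∑ x ∈ antidiagonal n with x.2 * a ≤ x.1 * b, klMomentTerm a b x.1 x.2
      ≤ ∑ x ∈ antidiagonal n with x.2 * a ≤ x.1 * b, g x := by
        refine Finset.sum_le_sum fun x hx => ?_
        obtain ⟨rfl, h⟩ : x.1 + x.2 = n ∧ x.2 * a ≤ x.1 * b := by simpa using hx
        exact klMomentTerm_le_sqrt_sub_sqrt ha hb h
    _ ≤ ∑ x ∈ antidiagonal n, g x := by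
        refine Finset.sum_le_sum_of_subset_of_nonneg (Finset.filter_subset _ _) fun x hx _ => ?_
        obtain rfl := mem_antidiagonal.mp hx
        have := sub_nonneg.mpr (Real.sqrt_le_sqrt (binomialTail_succ_le ha hb x.1 x.2))
        positivity
    _ = 2 * √((n : ℝ) ^ n * (a + b) ^ n) := by
        rw [Finset.Nat.sum_antidiagonal_eq_sum_range_succ_mk, ← Finset.mul_sum, ← Finset.mul_sum,
          Finset.sum_range_sub', binomialTail_zero, Real.sqrt_mul (by positivity)]
        simp [binomialTail]
        ring

lemma sum_antidiagonal_klMomentTerm_le (n : ℕ) :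
    ∑ x ∈ antidiagonal n, klMomentTerm a b x.1 x.2 ≤
      4 * √((n : ℝ) ^ n * (a + b) ^ n) := by
  have upper := sum_filter_klMomentTerm_le ha hb n
  have lower : ∑ x ∈ antidiagonal n with x.1 * b ≤ x.2 * a, klMomentTerm a b x.1 x.2 ≤
      2 * √((n : ℝ) ^ n * (a + b) ^ n) := by
    rw [Finset.sum_filter, ← Finset.Nat.sum_antidiagonal_swap, add_comm a b]
    simpa only [Finset.sum_filter, Prod.fst_swap, Prod.snd_swap, klMomentTerm_comm a b]
      using sum_filter_klMomentTerm_le hb ha n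
  have cover : ∑ x ∈ antidiagonal n with ¬ x.2 * a ≤ x.1 * b, klMomentTerm a b x.1 x.2 ≤
      ∑ x ∈ antidiagonal n with x.1 * b ≤ x.2 * a, klMomentTerm a b x.1 x.2 :=
    Finset.sum_le_sum_of_subset_of_nonneg
      (Finset.monotone_filter_right _ fun _ _ h => (not_le.mp h).le)
      fun _ _ _ => by unfold klMomentTerm; positivity
  rw [← Finset.sum_filter_add_sum_filter_not _ fun x : ℕ × ℕ => x.2 * a ≤ x.1 * b]
  linarith

end Binomial

/-! ### Multinomial sums -/

/-- For a probability vector `w` on `s` and `n = ∑ i ∈ s, N i`, this is `√(n ^ n)` times the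
contribution of the counts `N` to the expectation of `exp (n * KL / 2)`, where `KL` is the
divergence of the empirical distribution of `n` samples from `w`. -/
noncomputable def multinomialMomentTerm {ι : Type*} (s : Finset ι) (w : ι → ℝ) (N : ι → ℕ) : ℝ :=
  Nat.multinomial s N * ∏ i ∈ s, √(w i ^ N i * (N i : ℝ) ^ N i)

section Multinomial

variable {ι : Type*} {s : Finset ι} {w : ι → ℝ}

lemma multinomialMomentTerm_congr {N N' : ι → ℕ} (h : ∀ i ∈ s, N i = N' i) :
    multinomialMomentTerm s w N = multinomialMomentTerm s w N' := by
  rw [multinomialMomentTerm, multinomialMomentTerm, Nat.multinomial_congr h,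
    Finset.prod_congr rfl fun i hi => by rw [h i hi]]

lemma multinomialMomentTerm_cons {a : ι} (ha : a ∉ s) (N : ι → ℕ) :
    multinomialMomentTerm (Finset.cons a s ha) w N =
      (N a + ∑ i ∈ s, N i).choose (N a) * √(w a ^ N a * (N a : ℝ) ^ N a) *
        multinomialMomentTerm s w N := by
  rw [multinomialMomentTerm, multinomialMomentTerm, Nat.multinomial_cons ha, Finset.prod_cons]
  push_cast
  ring

variable [DecidableEq ι]

lemma sum_piAntidiag_cons_multinomialMomentTerm {a : ι} (ha : a ∉ s) (n : ℕ) :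
    ∑ N ∈ (Finset.cons a s ha).piAntidiag n, multinomialMomentTerm (Finset.cons a s ha) w N =
      ∑ x ∈ antidiagonal n, (x.1 + x.2).choose x.1 * √(w a ^ x.1 * (x.1 : ℝ) ^ x.1) *
        ∑ N ∈ s.piAntidiag x.2, multinomialMomentTerm s w N := by
  rw [Finset.piAntidiag_cons, Finset.sum_disjiUnion]
  refine Finset.sum_congr rfl fun x _ => ?_
  rw [Finset.sum_map, Finset.mul_sum]
  refine Finset.sum_congr rfl fun N hN => ?_
  obtain ⟨hsum, hsupp⟩ := Finset.mem_piAntidiag.mp hN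
  have hNa : N a = 0 := by_contra fun h => ha (hsupp a h)
  have extend_of_mem : ∀ i ∈ s,
      addRightEmbedding (fun t => if t = a then x.1 else 0) N i = N i := fun i hi => by
    simp [show i ≠ a from fun h => ha (h ▸ hi)]
  rw [multinomialMomentTerm_cons, multinomialMomentTerm_congr extend_of_mem,
    Finset.sum_congr rfl extend_of_mem, hsum]
  simp [hNa]

lemma sum_piAntidiag_multinomialMomentTerm_le (hw : ∀ i, 0 ≤ w i) (n : ℕ) :
    ∑ N ∈ s.piAntidiag n, multinomialMomentTerm s w N ≤
      4 ^ s.card * √((n : ℝ) ^ n * (∑ i ∈ s, w i) ^ n) := by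
  induction s using Finset.cons_induction generalizing n with
  | empty =>
    rcases Nat.eq_zero_or_pos n with rfl | hn
    · simp [multinomialMomentTerm]
    · simp [Finset.piAntidiag_empty_of_ne_zero hn.ne', hn.ne']
  | cons a s ha ih =>
    have hW : 0 ≤ ∑ i ∈ s, w i := Finset.sum_nonneg fun i _ => hw i
    have split_first (x : ℕ × ℕ) :
        ((x.1 + x.2).choose x.1 : ℝ) * √(w a ^ x.1 * (x.1 : ℝ) ^ x.1) *
          (4 ^ s.card * √((x.2 : ℝ) ^ x.2 * (∑ i ∈ s, w i) ^ x.2)) =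
        4 ^ s.card * klMomentTerm (w a) (∑ i ∈ s, w i) x.1 x.2 := by
      rw [klMomentTerm, mul_mul_mul_comm (w a ^ x.1),
        Real.sqrt_mul (mul_nonneg (pow_nonneg (hw a) _) (by positivity)),
        mul_comm ((∑ i ∈ s, w i) ^ x.2)]
      ring
    calc ∑ N ∈ (Finset.cons a s ha).piAntidiag n, multinomialMomentTerm (Finset.cons a s ha) w N
        ≤ ∑ x ∈ antidiagonal n, 4 ^ s.card * klMomentTerm (w a) (∑ i ∈ s, w i) x.1 x.2 := by
          rw [sum_piAntidiag_cons_multinomialMomentTerm]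
          refine Finset.sum_le_sum fun x _ => ?_
          rw [← split_first]
          gcongr
          exact ih x.2
      _ ≤ 4 ^ s.card * (4 * √((n : ℝ) ^ n * (w a + ∑ i ∈ s, w i) ^ n)) := by
          rw [← Finset.mul_sum]
          gcongr
          exact sum_antidiagonal_klMomentTerm_le (hw a) hW n
      _ = 4 ^ (Finset.cons a s ha).card *
            √((n : ℝ) ^ n * (∑ i ∈ Finset.cons a s ha, w i) ^ n) := by
          rw [Finset.card_cons, Finset.sum_cons]
          ring

end Multinomial

/-! ### Words and their letter counts -/

/-- The number of occurrences of the letter `i` in the word `s`. -/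
def letterCount {σ ι : Type*} [Fintype σ] [DecidableEq ι] (s : σ → ι) (i : ι) : ℕ :=
  (Finset.univ.filter fun j => s j = i).card

section LetterCount

variable {σ ι : Type*} [Fintype σ] [Fintype ι] [DecidableEq ι]

lemma sum_letterCount (s : σ → ι) : ∑ i, letterCount s i = Fintype.card σ :=
  (Finset.card_eq_sum_card_fiberwise fun _ _ => Finset.mem_univ _).symm

lemma prod_comp_eq_prod_pow_letterCount {M : Type*} [CommMonoid M] (s : σ → ι) (w : ι → M) :
    ∏ j, w (s j) = ∏ i, w i ^ letterCount s i := by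
  simp_rw [← Finset.prod_fiberwise' Finset.univ s w, Finset.prod_const, letterCount]

/-- The multinomial theorem in the polynomial ring, read through the linear map that sends the
monomial with exponents `N` to `F N`. -/
lemma sum_letterCount_eq_sum_piAntidiag {M : Type*} [AddCommMonoid M] (n : ℕ) (F : (ι → ℕ) → M) :
    ∑ s : Fin n → ι, F (letterCount s) =
      ∑ N ∈ Finset.univ.piAntidiag n, Nat.multinomial Finset.univ N • F N := by
  let X (i : ι) : MvPolynomial ι ℕ := MvPolynomial.X i
  let φ : MvPolynomial ι ℕ →ₗ[ℕ] M := (MvPolynomial.basisMonomials ι ℕ).constr ℕ fun N => F N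
  have map_monomial (N : ι → ℕ) : φ (∏ i, X i ^ N i) = F N := by
    have monomial_eq : ∏ i, X i ^ N i =
        MvPolynomial.basisMonomials ι ℕ (Finsupp.equivFunOnFinite.symm N) := by
      simp [X, MvPolynomial.monomial_eq, Finsupp.prod_fintype]
    rw [monomial_eq, Module.Basis.constr_basis]
    simp
  calc ∑ s : Fin n → ι, F (letterCount s) = φ ((∑ i, X i) ^ n) := by
        rw [Finset.sum_pow', map_sum, Fintype.piFinset_univ]
        exact Finset.sum_congr rfl fun s _ => by
          rw [prod_comp_eq_prod_pow_letterCount, map_monomial]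
    _ = ∑ N ∈ Finset.univ.piAntidiag n, Nat.multinomial Finset.univ N • F N := by
        rw [Finset.sum_pow_eq_sum_piAntidiag, map_sum]
        exact Finset.sum_congr rfl fun N _ => by rw [← nsmul_eq_mul, map_nsmul, map_monomial]

lemma sum_sqrt_prod_mul_prod_letterCount_le {w : ι → ℝ} (hw : ∀ i, 0 ≤ w i) (n : ℕ) :
    ∑ s : Fin n → ι, √((∏ j, w (s j)) * ∏ i, (letterCount s i : ℝ) ^ letterCount s i) ≤
      4 ^ Fintype.card ι * √((n : ℝ) ^ n * (∑ i, w i) ^ n) := by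
  have sqrt_eq_prod (s : Fin n → ι) :
      √((∏ j, w (s j)) * ∏ i, (letterCount s i : ℝ) ^ letterCount s i) =
        ∏ i, √(w i ^ letterCount s i * (letterCount s i : ℝ) ^ letterCount s i) := by
    rw [prod_comp_eq_prod_pow_letterCount, ← Finset.prod_mul_distrib, Real.sqrt_prod]
    exact fun i _ => mul_nonneg (pow_nonneg (hw i) _) (by positivity)
  simp_rw [sqrt_eq_prod]
  rw [sum_letterCount_eq_sum_piAntidiag n fun N => ∏ i, √(w i ^ N i * (N i : ℝ) ^ N i)]
  simpa only [nsmul_eq_mul, multinomialMomentTerm, Finset.card_univ] using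
    sum_piAntidiag_multinomialMomentTerm_le (s := Finset.univ) hw n

end LetterCount

/-! ### Kullback-Leibler divergence on a finite type -/

section SingletonMeasure

variable {α : Type*} [MeasurableSpace α] {μ ν : Measure α}

lemma absolutelyContinuous_iff_forall_singleton [Countable α] :
    μ ≪ ν ↔ ∀ a, ν {a} = 0 → μ {a} = 0 := by
  refine ⟨fun h a ha => h ha, fun h => Measure.AbsolutelyContinuous.mk fun s _ hs => ?_⟩
  rw [← Set.biUnion_of_singleton s, measure_biUnion_null_iff s.to_countable]
  exact fun a ha => h a (measure_mono_null (Set.singleton_subset_iff.mpr ha) hs)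

lemma measureReal_pi_singleton {σ : Type*} [Fintype σ] [SigmaFinite μ] (s : σ → α) :
    (Measure.pi fun _ : σ => μ).real {s} = ∏ j, μ.real {s j} := by
  simp only [measureReal_def, Measure.pi_singleton, ENNReal.toReal_prod]

lemma measure_singleton_ne_zero_of_letterCount_ne_zero {σ : Type*} [Fintype σ] [DecidableEq α]
    [SigmaFinite μ] {s : σ → α} (hs : (Measure.pi fun _ : σ => μ) {s} ≠ 0) {a : α}
    (ha : letterCount s a ≠ 0) : μ {a} ≠ 0 := by
  obtain ⟨j, hj⟩ := Finset.card_ne_zero.mp ha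
  rw [← (Finset.mem_filter.mp hj).2]
  rw [Measure.pi_singleton] at hs
  exact Finset.prod_ne_zero_iff.mp hs j (Finset.mem_univ j)

variable [MeasurableSingletonClass α]

lemma measureReal_singleton_mul_toReal_rnDeriv [SigmaFinite μ] [SigmaFinite ν] (h : μ ≪ ν)
    (a : α) : ν.real {a} * (μ.rnDeriv ν a).toReal = μ.real {a} := by
  rw [← Measure.setIntegral_toReal_rnDeriv h, integral_singleton, smul_eq_mul]

lemma klDiv_ne_top_of_finite [Finite α] [IsFiniteMeasure μ] (h : μ ≪ ν) : klDiv μ ν ≠ ∞ :=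
  klDiv_ne_top h Integrable.of_finite

lemma toReal_klDiv_eq_sum [Fintype α] [IsFiniteMeasure μ] [SigmaFinite ν] (h : μ ≪ ν)
    (h_eq : μ Set.univ = ν Set.univ) :
    (klDiv μ ν).toReal = ∑ a, μ.real {a} * Real.log (μ.real {a} / ν.real {a}) := by
  have : IsFiniteMeasure ν := ⟨h_eq ▸ measure_lt_top μ _⟩
  rw [toReal_klDiv_of_measure_eq h h_eq, integral_fintype Integrable.of_finite]
  refine Finset.sum_congr rfl fun a _ => ?_
  rw [smul_eq_mul, llr_def, ← measureReal_singleton_mul_toReal_rnDeriv h a]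
  rcases eq_or_ne (ν.real {a}) 0 with hν | hν
  · simp [hν]
  · rw [mul_div_cancel_left₀ _ hν]

lemma measurable_klDiv_left [Finite α] (ν : Measure α) [IsProbabilityMeasure ν] :
    Measurable fun q : ProbabilityMeasure α => klDiv (q : Measure α) ν := by
  have := Fintype.ofFinite α
  have measurable_apply (s : Set α) :
      Measurable fun q : ProbabilityMeasure α => (q : Measure α) s :=
    (Measure.measurable_coe s.toFinite.measurableSet).comp measurable_subtype_coe
  have measurableSet_ac : MeasurableSet {q : ProbabilityMeasure α | (q : Measure α) ≪ ν} := by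
    simp only [absolutelyContinuous_iff_forall_singleton, Set.ofPred_forall]
    exact MeasurableSet.iInter fun a => MeasurableSet.iInter fun _ =>
      measurable_apply {a} (measurableSet_singleton 0)
  have measurable_sum : Measurable fun q : ProbabilityMeasure α =>
      ∑ a, (q : Measure α).real {a} * Real.log ((q : Measure α).real {a} / ν.real {a}) :=
    Finset.measurable_sum _ fun a _ =>
      (measurable_apply {a}).ennreal_toReal.mul
        ((measurable_apply {a}).ennreal_toReal.div_const _).log
  classical
  suffices heq : (fun q : ProbabilityMeasure α => klDiv (q : Measure α) ν) =
      fun q : ProbabilityMeasure α => if (q : Measure α) ≪ ν then ENNReal.ofReal (∑ a,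
        (q : Measure α).real {a} * Real.log ((q : Measure α).real {a} / ν.real {a})) else ∞ by
    rw [heq]
    exact measurable_sum.ennreal_ofReal.ite measurableSet_ac measurable_const
  ext q
  split_ifs with h
  · rw [← toReal_klDiv_eq_sum h (by simp), ENNReal.ofReal_toReal (klDiv_ne_top_of_finite h)]
  · exact klDiv_of_not_ac h

end SingletonMeasure

/-! ### The empirical distribution -/

section Empirical

variable {k n : ℕ} [NeZero n]

lemma measureReal_empiricalDistr_singleton (s : Fin n → Fin k) (i : Fin k) :
    (empiricalDistr s : Measure (Fin k)).real {i} = letterCount s i / n := by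
  have : (empiricalDistr s : Measure (Fin k)) {i} = (n : ℝ≥0∞)⁻¹ * letterCount s i := by
    simp [empiricalDistr, letterCount, Set.indicator_apply, Finset.sum_boole]
  simp [measureReal_def, this, div_eq_inv_mul]

lemma empiricalDistr_absolutelyContinuous {p : Distr k} {s : Fin n → Fin k}
    (hs : (Measure.pi fun _ : Fin n => (p : Measure (Fin k))) {s} ≠ 0) :
    (empiricalDistr s : Measure (Fin k)) ≪ p := by
  refine absolutelyContinuous_iff_forall_singleton.mpr fun i hi => ?_
  have hcount : letterCount s i = 0 :=
    by_contra fun h => measure_singleton_ne_zero_of_letterCount_ne_zero hs h hi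
  rw [← measureReal_eq_zero_iff, measureReal_empiricalDistr_singleton, hcount]
  simp

/-- The empirical distribution has the largest likelihood, and `exp (n * KL)` is the likelihood
ratio to the true distribution. -/
lemma measureReal_pi_mul_exp_klLoss {p : Distr k} {s : Fin n → Fin k}
    (hs : (Measure.pi fun _ : Fin n => (p : Measure (Fin k))) {s} ≠ 0) :
    (Measure.pi fun _ : Fin n => (p : Measure (Fin k))).real {s} *
        Real.exp (n * (klLoss (empiricalDistr s) p).toReal) =
      (∏ i, (letterCount s i : ℝ) ^ letterCount s i) / (n : ℝ) ^ n := by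
  have hn : (n : ℝ) ≠ 0 := Nat.cast_ne_zero.mpr (NeZero.ne n)
  have pow_eq_prod : (n : ℝ) ^ n = ∏ i, (n : ℝ) ^ letterCount s i := by
    rw [Finset.prod_pow_eq_pow_sum, sum_letterCount, Fintype.card_fin]
  rw [klLoss, toReal_klDiv_eq_sum (empiricalDistr_absolutelyContinuous hs) (by simp),
    measureReal_pi_singleton,
    prod_comp_eq_prod_pow_letterCount s fun i => (p : Measure (Fin k)).real {i}, pow_eq_prod,
    ← Finset.prod_div_distrib, Finset.mul_sum, Real.exp_sum, ← Finset.prod_mul_distrib]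
  refine Finset.prod_congr rfl fun i _ => ?_
  rw [measureReal_empiricalDistr_singleton, ← mul_assoc, mul_div_cancel₀ _ hn]
  rcases Nat.eq_zero_or_pos (letterCount s i) with hi | hi
  · simp [hi]
  · have hp : 0 < (p : Measure (Fin k)).real {i} := ENNReal.toReal_pos
      (measure_singleton_ne_zero_of_letterCount_ne_zero hs hi.ne') (measure_ne_top _ _)
    have hc : (0 : ℝ) < letterCount s i / n := by positivity
    rw [← Real.log_pow, Real.exp_log (pow_pos (div_pos hc hp) _), ← div_pow, ← mul_pow,
      mul_div_cancel₀ _ hp.ne']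

lemma mgf_klLoss_empiricalDistr_le (p : Distr k) :
    mgf (fun s => (klLoss (empiricalDistr s) p).toReal)
        (Measure.pi fun _ : Fin n => (p : Measure (Fin k))) (n / 2) ≤ 4 ^ k := by
  set P := Measure.pi fun _ : Fin n => (p : Measure (Fin k)) with hP
  have hn : 0 < √((n : ℝ) ^ n) := by have := NeZero.pos n; positivity
  have term_eq (s : Fin n → Fin k) :
      P.real {s} * Real.exp (n / 2 * (klLoss (empiricalDistr s) p).toReal) =
        √((∏ j, (p : Measure (Fin k)).real {s j}) *
          ∏ i, (letterCount s i : ℝ) ^ letterCount s i) / √((n : ℝ) ^ n) := by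
    rw [← measureReal_pi_singleton]
    rcases eq_or_ne (P {s}) 0 with hs | hs
    · simp [← hP, measureReal_def, hs]
    · rw [← Real.sqrt_div' _ (by positivity), mul_div_assoc, ← measureReal_pi_mul_exp_klLoss hs,
        ← mul_assoc, Real.sqrt_mul (mul_self_nonneg _), Real.sqrt_mul_self measureReal_nonneg,
        div_mul_eq_mul_div, Real.exp_half]
  calc mgf (fun s => (klLoss (empiricalDistr s) p).toReal) P (n / 2)
      = (∑ s : Fin n → Fin k, √((∏ j, (p : Measure (Fin k)).real {s j}) *
          ∏ i, (letterCount s i : ℝ) ^ letterCount s i)) / √((n : ℝ) ^ n) := by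
        rw [mgf, integral_fintype Integrable.of_finite, Finset.sum_div]
        exact Finset.sum_congr rfl fun s _ => term_eq s
    _ ≤ 4 ^ k := by
        rw [div_le_iff₀ hn]
        simpa [sum_measureReal_singleton, -ProbabilityMeasure.measureReal_eq_coe_coeFn]
          using sum_sqrt_prod_mul_prod_letterCount_le
          (w := fun i => (p : Measure (Fin k)).real {i}) (fun _ => measureReal_nonneg) n

lemma measureReal_lt_klLoss_empiricalDistr_le (p : Distr k) {ε : ℝ} (hε : 0 ≤ ε) :
    (Measure.pi fun _ : Fin n => (p : Measure (Fin k))).real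
        {s | ENNReal.ofReal ε < klLoss (empiricalDistr s) p} ≤
      Real.exp (-(n / 2) * ε) * 4 ^ k := by
  set P := Measure.pi fun _ : Fin n => (p : Measure (Fin k))
  have le_toReal : {s | ENNReal.ofReal ε < klLoss (empiricalDistr s) p} ≤ᵐ[P]
      {s | ε ≤ (klLoss (empiricalDistr s) p).toReal} := by
    refine ae_iff_of_countable.mpr fun s hs hlt => ?_
    have hac := empiricalDistr_absolutelyContinuous hs
    exact ((ENNReal.ofReal_lt_iff_lt_toReal hε (klDiv_ne_top_of_finite hac)).mp hlt).le
  calc P.real {s | ENNReal.ofReal ε < klLoss (empiricalDistr s) p}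
      ≤ P.real {s | ε ≤ (klLoss (empiricalDistr s) p).toReal} :=
        ENNReal.toReal_mono (measure_ne_top _ _) (measure_mono_ae le_toReal)
    _ ≤ Real.exp (-(n / 2) * ε) * mgf (fun s => (klLoss (empiricalDistr s) p).toReal) P (n / 2) :=
        measure_ge_le_exp_mul_mgf ε (by positivity) Integrable.of_finite
    _ ≤ Real.exp (-(n / 2) * ε) * 4 ^ k := by
        gcongr
        exact mgf_klLoss_empiricalDistr_le p

lemma outputLaw_empiricalEstimator (p : Distr k) :
    (empiricalEstimator k n).outputLaw p =
      (Measure.pi fun _ : Fin n => (p : Measure (Fin k))).map empiricalDistr :=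
  Measure.deterministic_comp_eq_map Measurable.of_discrete

lemma measurableSet_lt_klLoss (p : Distr k) (c : ℝ≥0∞) : MeasurableSet {q | c < klLoss q p} :=
  measurableSet_lt measurable_const (measurable_klDiv_left (p : Measure (Fin k)))

end Empirical

lemma empiricalEstimator_learns_klLoss {k n : ℕ} [NeZero n] {ε δ : ℝ} (hε : 0 < ε) (hδ : 0 < δ)
    (hδ1 : δ ≤ 1) (hn : 4 * ((k + Real.log (1 / δ)) / ε) ≤ n) :
    (empiricalEstimator k n).Learns klLoss ε δ := by
  intro p
  rw [outputLaw_empiricalEstimator,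
    Measure.map_apply Measurable.of_discrete (measurableSet_lt_klLoss p _), ← ofReal_measureReal]
  refine ENNReal.ofReal_le_ofReal
    ((measureReal_lt_klLoss_empiricalDistr_le p hε.le).trans ?_)
  have four_le : (4 : ℝ) ≤ Real.exp 2 := by
    have := Real.add_one_le_exp 1
    rw [show (2 : ℝ) = 1 + 1 by norm_num, Real.exp_add]
    nlinarith
  have hlog : 0 ≤ Real.log (1 / δ) := Real.log_nonneg ((one_le_div hδ).mpr hδ1)
  have hnε : 4 * (k + Real.log (1 / δ)) ≤ n * ε := by rwa [mul_div_assoc', div_le_iff₀ hε] at hn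
  calc Real.exp (-(n / 2) * ε) * 4 ^ k
      ≤ Real.exp (-(n / 2) * ε) * Real.exp 2 ^ k := by gcongr
    _ = Real.exp (2 * k - n * ε / 2) := by
        rw [← Real.exp_nat_mul, ← Real.exp_add]
        ring_nf
    _ ≤ Real.exp (-Real.log (1 / δ)) := by
        gcongr
        linarith
    _ = δ := by rw [one_div, Real.log_inv, neg_neg, Real.exp_log hδ]

lemma Estimator.Learns.sampleComplexity_le {k n : ℕ} {d : Distr k → Distr k → ℝ≥0∞} {ε δ : ℝ}
    {A : Estimator k n} (hA : A.Learns d ε δ) : sampleComplexity d ε δ ≤ n :=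
  iInf₂_le n ⟨A, hA⟩

lemma sampleComplexity_klLoss_le {k : ℕ} (hk : 1 ≤ k) {ε δ : ℝ} (hε : 0 < ε) (hε1 : ε ≤ 1)
    (hδ : 0 < δ) (hδ1 : δ ≤ 1) :
    ((sampleComplexity (klLoss (k := k)) ε δ : ℕ∞) : ℝ≥0∞) ≤
      ENNReal.ofReal (5 * ((k + Real.log (1 / δ)) / ε)) := by
  have hlog : 0 ≤ Real.log (1 / δ) := Real.log_nonneg ((one_le_div hδ).mpr hδ1)
  have hk' : (1 : ℝ) ≤ k := by exact_mod_cast hk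
  set x := (k + Real.log (1 / δ)) / ε
  have one_le_x : 1 ≤ x := (one_le_div hε).mpr (by linarith)
  have : NeZero ⌈4 * x⌉₊ := ⟨(Nat.ceil_pos.mpr (by linarith)).ne'⟩
  have hlearns : (empiricalEstimator k ⌈4 * x⌉₊).Learns klLoss ε δ :=
    empiricalEstimator_learns_klLoss hε hδ hδ1 (Nat.le_ceil _)
  calc ((sampleComplexity (klLoss (k := k)) ε δ : ℕ∞) : ℝ≥0∞)
      ≤ ((⌈4 * x⌉₊ : ℕ∞) : ℝ≥0∞) := ENat.toENNReal_le.mpr hlearns.sampleComplexity_le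
    _ = ENNReal.ofReal ⌈4 * x⌉₊ := by rw [ENat.toENNReal_coe, ENNReal.ofReal_natCast]
    _ ≤ ENNReal.ofReal (5 * x) :=
        ENNReal.ofReal_le_ofReal (by linarith [Nat.ceil_lt_add_one (a := 4 * x) (by linarith)])

/-! ### Hellinger affinity and two-point testing -/

lemma sq_sqrt_sub_one_le_klFun {x : ℝ} (hx : 0 ≤ x) : (√x - 1) ^ 2 ≤ klFun x := by
  rcases hx.eq_or_lt with rfl | hx
  · simp [klFun_zero]
  have one_sub_inv_le : 1 - (√x)⁻¹ ≤ Real.log x / 2 := by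
    rw [← Real.log_sqrt hx.le]
    exact Real.one_sub_inv_le_log_of_pos (Real.sqrt_pos.mpr hx)
  have mul_one_sub_inv : x * (1 - (√x)⁻¹) = x - √x := by
    rw [mul_sub, mul_one, ← div_eq_mul_inv, Real.div_sqrt]
  calc (√x - 1) ^ 2 = 2 * (x - √x) + 1 - x := by linear_combination Real.sq_sqrt hx.le
    _ ≤ 2 * (x * (Real.log x / 2)) + 1 - x := by
        rw [← mul_one_sub_inv]
        gcongr
    _ = klFun x := by
        rw [klFun_apply]
        ring

section Hellinger

variable {α β : Type*} [Fintype α] [MeasurableSpace α] [MeasurableSpace β]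

/-- The Hellinger affinity (Bhattacharyya coefficient) of two measures on a finite type. It is
multiplicative over independent samples, and it is small when the measures can be told apart. -/
noncomputable def hellingerAffinity (μ ν : Measure α) : ℝ :=
  ∑ a, √(μ.real {a}) * √(ν.real {a})

/-- The squared Hellinger distance of two measures on a finite type, without the factor `1 / 2`
that some authors include. -/
noncomputable def sqHellingerDist (μ ν : Measure α) : ℝ :=
  ∑ a, (√(μ.real {a}) - √(ν.real {a})) ^ 2

lemma hellingerAffinity_pi {σ : Type*} [Fintype σ] [DecidableEq σ] (μ ν : Measure α)
    [SigmaFinite μ] [SigmaFinite ν] :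
    hellingerAffinity (Measure.pi fun _ : σ => μ) (Measure.pi fun _ : σ => ν) =
      hellingerAffinity μ ν ^ Fintype.card σ := by
  rw [hellingerAffinity, hellingerAffinity, ← Finset.card_univ, ← Finset.prod_const,
    Finset.prod_univ_sum, Fintype.piFinset_univ]
  refine Finset.sum_congr rfl fun s _ => ?_
  rw [measureReal_pi_singleton, measureReal_pi_singleton,
    Real.sqrt_prod _ fun _ _ => measureReal_nonneg, Real.sqrt_prod _ fun _ _ => measureReal_nonneg,
    Finset.prod_mul_distrib]

variable [MeasurableSingletonClass α]

lemma sqHellingerDist_le_toReal_klDiv {μ ν : Measure α} [IsFiniteMeasure μ] [IsFiniteMeasure ν]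
    (h : μ ≪ ν) : sqHellingerDist μ ν ≤ (klDiv μ ν).toReal := by
  rw [sqHellingerDist, toReal_klDiv_eq_integral_klFun h, integral_fintype Integrable.of_finite]
  refine Finset.sum_le_sum fun a _ => ?_
  rw [← measureReal_singleton_mul_toReal_rnDeriv h a, Real.sqrt_mul measureReal_nonneg]
  calc (√(ν.real {a}) * √(μ.rnDeriv ν a).toReal - √(ν.real {a})) ^ 2
      = ν.real {a} * (√(μ.rnDeriv ν a).toReal - 1) ^ 2 := by
        rw [← mul_sub_one, mul_pow, Real.sq_sqrt measureReal_nonneg]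
    _ ≤ ν.real {a} * klFun (μ.rnDeriv ν a).toReal := by
        gcongr
        exact sq_sqrt_sub_one_le_klFun ENNReal.toReal_nonneg

lemma measureReal_bind_eq_sum (μ : Measure α) [IsFiniteMeasure μ] (κ : Kernel α β)
    [IsFiniteKernel κ] {B : Set β} (hB : MeasurableSet B) :
    (μ.bind κ).real B = ∑ a, μ.real {a} * (κ a).real B := by
  rw [measureReal_def, Measure.bind_apply hB κ.measurable.aemeasurable, lintegral_fintype,
    ENNReal.toReal_sum fun a _ => ENNReal.mul_ne_top (measure_ne_top _ _) (measure_ne_top _ _)]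
  simp only [ENNReal.toReal_mul, measureReal_def, mul_comm]

lemma sum_sqrt_mul_sqrt_mul_measureReal_le (μ ν : Measure α) [IsFiniteMeasure μ]
    [IsProbabilityMeasure ν] (κ : Kernel α β) [IsMarkovKernel κ] {B : Set β}
    (hB : MeasurableSet B) :
    ∑ a, √(μ.real {a}) * √(ν.real {a}) * (κ a).real B ≤ √((μ.bind κ).real B) := by
  calc ∑ a, √(μ.real {a}) * √(ν.real {a}) * (κ a).real B
      = ∑ a, √(μ.real {a} * (κ a).real B) * √(ν.real {a} * (κ a).real B) := by
        refine Finset.sum_congr rfl fun a _ => ?_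
        rw [Real.sqrt_mul measureReal_nonneg, Real.sqrt_mul measureReal_nonneg, mul_mul_mul_comm,
          Real.mul_self_sqrt measureReal_nonneg]
    _ ≤ √((μ.bind κ).real B) * √((ν.bind κ).real B) := by
        rw [measureReal_bind_eq_sum μ κ hB, measureReal_bind_eq_sum ν κ hB]
        exact Real.sum_sqrt_mul_sqrt_le _ (fun _ => by positivity) fun _ => by positivity
    _ ≤ √((μ.bind κ).real B) :=
        mul_le_of_le_one_right (Real.sqrt_nonneg _) (Real.sqrt_le_one.mpr measureReal_le_one)

/-- Le Cam's two-point bound: the test `B` splits the affinity into two sums, and Cauchy-Schwarz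
bounds each of them by one of the error probabilities. -/
lemma hellingerAffinity_sq_le (μ ν : Measure α) [IsProbabilityMeasure μ] [IsProbabilityMeasure ν]
    (κ : Kernel α β) [IsMarkovKernel κ] {B : Set β} (hB : MeasurableSet B) :
    hellingerAffinity μ ν ^ 2 ≤ 2 * ((μ.bind κ).real B + (ν.bind κ).real Bᶜ) := by
  have split_affinity : hellingerAffinity μ ν =
      ∑ a, √(μ.real {a}) * √(ν.real {a}) * (κ a).real B +
        ∑ a, √(ν.real {a}) * √(μ.real {a}) * (κ a).real Bᶜ := by
    rw [hellingerAffinity, ← Finset.sum_add_distrib]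
    refine Finset.sum_congr rfl fun a _ => ?_
    rw [probReal_compl_eq_one_sub hB]
    ring
  have affinity_le : hellingerAffinity μ ν ≤
      √((μ.bind κ).real B) + √((ν.bind κ).real Bᶜ) :=
    split_affinity.trans_le (add_le_add (sum_sqrt_mul_sqrt_mul_measureReal_le μ ν κ hB)
      (sum_sqrt_mul_sqrt_mul_measureReal_le ν μ κ hB.compl))
  have affinity_nonneg : 0 ≤ hellingerAffinity μ ν := Finset.sum_nonneg fun _ _ => by positivity
  calc hellingerAffinity μ ν ^ 2
      ≤ (√((μ.bind κ).real B) + √((ν.bind κ).real Bᶜ)) ^ 2 := by gcongr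
    _ ≤ 2 * (√((μ.bind κ).real B) ^ 2 + √((ν.bind κ).real Bᶜ) ^ 2) := add_sq_le
    _ = 2 * ((μ.bind κ).real B + (ν.bind κ).real Bᶜ) := by
        rw [Real.sq_sqrt measureReal_nonneg, Real.sq_sqrt measureReal_nonneg]

end Hellinger

/-! ### Assouad's lemma -/

lemma integral_le_add_mul_measureReal_lt {β : Type*} [MeasurableSpace β] {μ : Measure β}
    [IsProbabilityMeasure μ] {X : β → ℝ} {t M : ℝ} (hX : Measurable X) (hX_nonneg : 0 ≤ X)
    (hX_le : ∀ b, X b ≤ M) (ht : 0 ≤ t) : ∫ b, X b ∂μ ≤ t + M * μ.real {b | t < X b} := by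
  have measurableSet_lt_X : MeasurableSet {b | t < X b} := measurableSet_lt measurable_const hX
  have integrable_bound : Integrable ({b | t < X b}.indicator fun _ => M) μ :=
    (integrable_const M).indicator measurableSet_lt_X
  calc ∫ b, X b ∂μ ≤ ∫ b, t + {b | t < X b}.indicator (fun _ => M) b ∂μ := by
        refine integral_mono_of_nonneg (.of_forall hX_nonneg)
          ((integrable_const t).add integrable_bound) (.of_forall fun b => ?_)
        rcases lt_or_ge t (X b) with hb | hb
        · simpa [hb] using (hX_le b).trans (le_add_of_nonneg_left ht)
        · simpa [hb.not_gt] using hb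
    _ = t + M * μ.real {b | t < X b} := by
        rw [integral_add (integrable_const t) integrable_bound, integral_const,
          integral_indicator_const M measurableSet_lt_X, probReal_univ, one_smul, smul_eq_mul,
          mul_comm M]

section Assouad

variable {ι β : Type*} [MeasurableSpace β] {g : β → ι → Bool}

lemma measurableSet_apply_ne (hg : Measurable g) (j : ι) (b : Bool) :
    MeasurableSet {q | g q j ≠ b} :=
  ((measurable_pi_apply j).comp hg (measurableSet_singleton b)).compl

lemma integral_hammingDist [Fintype ι] (hg : Measurable g) (μ : Measure β) [IsFiniteMeasure μ]
    (v : ι → Bool) :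
    ∫ q, (hammingDist (g q) v : ℝ) ∂μ = ∑ j, μ.real {q | g q j ≠ v j} := by
  have hammingDist_eq_sum (q : β) : (hammingDist (g q) v : ℝ) =
      ∑ j, {q | g q j ≠ v j}.indicator (fun _ => (1 : ℝ)) q := by
    simp only [hammingDist, Finset.natCast_card_filter, Set.indicator_apply, Set.mem_ofPred_eq]
  simp_rw [hammingDist_eq_sum]
  rw [integral_finsetSum _ fun j _ =>
    (integrable_const (1 : ℝ)).indicator (measurableSet_apply_ne hg j _)]
  exact Finset.sum_congr rfl fun j _ => by
    rw [integral_indicator_const _ (measurableSet_apply_ne hg j _), smul_eq_mul, mul_one]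

/-- Averaged over the cube, every coordinate is decoded wrongly with probability at least `a / 4`:
pair each vertex with its neighbour across that coordinate and apply Le Cam's bound. -/
lemma exists_card_mul_div_four_le_integral_hammingDist [Fintype ι]
    [DecidableEq ι] {α : Type*} [Fintype α] [MeasurableSpace α] [MeasurableSingletonClass α]
    (P : (ι → Bool) → Measure α) [∀ v, IsProbabilityMeasure (P v)]
    (κ : Kernel α β) [IsMarkovKernel κ] (hg : Measurable g) {a : ℝ}
    (ha : ∀ v j, a ≤ hellingerAffinity (P v) (P (Function.update v j !v j)) ^ 2) :
    ∃ v, Fintype.card ι * a / 4 ≤ ∫ q, (hammingDist (g q) v : ℝ) ∂(P v).bind κ := by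
  let flip (j : ι) (v : ι → Bool) : ι → Bool := Function.update v j !v j
  have flip_involutive (j : ι) : (flip j).Involutive := fun v => by simp [flip]
  let err (v : ι → Bool) (j : ι) : ℝ := ((P v).bind κ).real {q | g q j ≠ v j}
  have le_err_add_err_flip (v : ι → Bool) (j : ι) : a / 2 ≤ err v j + err (flip j v) j := by
    have compl_eq : {q | g q j ≠ v j}ᶜ = {q | g q j ≠ flip j v j} := by
      ext q
      simp [flip]
    have leCam := hellingerAffinity_sq_le (P v) (P (flip j v)) κ
      (measurableSet_apply_ne hg j (v j))
    rw [compl_eq] at leCam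
    linarith [ha v j]
  have le_sum_err (j : ι) : ∑ _v : ι → Bool, a / 4 ≤ ∑ v, err v j := by
    have sum_err_flip : ∑ v, err (flip j v) j = ∑ v, err v j :=
      Equiv.sum_comp (flip_involutive j).toPerm fun v => err v j
    have := Finset.sum_le_sum fun v (_ : v ∈ Finset.univ) => le_err_add_err_flip v j
    rw [Finset.sum_add_distrib, sum_err_flip] at this
    calc ∑ _v : ι → Bool, a / 4 = (∑ _v : ι → Bool, a / 2) / 2 := by
          rw [Finset.sum_div]
          ring_nf
      _ ≤ ∑ v, err v j := by linarith
  have le_sum_sum_err : ∑ _v : ι → Bool, Fintype.card ι * a / 4 ≤ ∑ v, ∑ j, err v j := by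
    calc ∑ _v : ι → Bool, Fintype.card ι * a / 4 = ∑ _j : ι, ∑ _v : ι → Bool, a / 4 := by
          simp only [Finset.sum_const, Finset.card_univ, nsmul_eq_mul]
          ring
      _ ≤ ∑ j, ∑ v, err v j := Finset.sum_le_sum fun j _ => le_sum_err j
      _ = ∑ v, ∑ j, err v j := Finset.sum_comm
  obtain ⟨v, -, hv⟩ := Finset.exists_le_of_sum_le Finset.univ_nonempty le_sum_sum_err
  exact ⟨v, hv.trans_eq (integral_hammingDist hg _ v).symm⟩

end Assouad

/-! ### A family of distributions that are hard to tell apart -/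

section PairDecoder

variable {ι α : Type*} [MeasurableSpace α] {e : ι × Bool ↪ α}

/-- The vertex of the cube that records which letter of each pair is the likelier one under `q`,
with ties resolved to `false`. -/
noncomputable def pairDecoder (e : ι × Bool ↪ α) (q : ProbabilityMeasure α) (j : ι) : Bool :=
  decide ((q : Measure α).real {e (j, false)} < (q : Measure α).real {e (j, true)})

lemma measurable_pairDecoder [MeasurableSingletonClass α] : Measurable (pairDecoder e) := by
  have measurable_apply (x : ι × Bool) :
      Measurable fun q : ProbabilityMeasure α => (q : Measure α).real {e x} :=
    ((Measure.measurable_coe (measurableSet_singleton (e x))).comp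
      measurable_subtype_coe).ennreal_toReal
  refine measurable_pi_lambda _ fun j => measurable_to_bool ?_
  simpa [pairDecoder, Set.preimage] using
    measurableSet_lt (measurable_apply (j, false)) (measurable_apply (j, true))

end PairDecoder

section PairDistr

variable {ι α : Type*} [Fintype ι]

/-- The probability vector on pairs of letters that gives every pair the same total mass and, within
the `j`-th pair, favours the letter `v j` with bias `η`. -/
noncomputable def pairMass (η : ℝ) (v : ι → Bool) (x : ι × Bool) : ℝ :=
  (1 + if x.2 = v x.1 then η else -η) / (2 * Fintype.card ι)

lemma pairMass_self (η : ℝ) (v : ι → Bool) (j : ι) :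
    pairMass η v (j, v j) = (1 + η) / (2 * Fintype.card ι) := by
  simp [pairMass]

lemma pairMass_not (η : ℝ) (v : ι → Bool) (j : ι) :
    pairMass η v (j, !v j) = (1 - η) / (2 * Fintype.card ι) := by
  simp [pairMass, sub_eq_add_neg]

lemma pairMass_nonneg (η : unitInterval) (v : ι → Bool) (x : ι × Bool) :
    0 ≤ pairMass η v x := by
  have := η.2.1
  have := η.2.2
  unfold pairMass
  refine div_nonneg ?_ (by positivity)
  split_ifs <;> linarith

lemma sum_prod_bool_eq_sum_self_add_not (v : ι → Bool) (f : ι × Bool → ℝ) :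
    ∑ x, f x = ∑ j, (f (j, v j) + f (j, !v j)) := by
  rw [Fintype.sum_prod_type]
  refine Finset.sum_congr rfl fun j _ => ?_
  cases v j <;> simp [add_comm]

lemma sum_pairMass [Nonempty ι] (η : ℝ) (v : ι → Bool) : ∑ x, pairMass η v x = 1 := by
  have hcard : (Fintype.card ι : ℝ) ≠ 0 := Nat.cast_ne_zero.mpr Fintype.card_ne_zero
  rw [sum_prod_bool_eq_sum_self_add_not v]
  simp only [pairMass_self, pairMass_not, Finset.sum_const, Finset.card_univ, nsmul_eq_mul]
  field_simp
  ring

lemma sqrt_one_add_mul_sqrt_one_sub (η : unitInterval) {c : ℝ} (hc : 0 ≤ c) :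
    √((1 + η) / c) * √((1 - η) / c) = √(1 - (η : ℝ) ^ 2) / c := by
  have := η.2.1
  rw [← Real.sqrt_mul (by positivity), div_mul_div_comm, Real.sqrt_div' _ (by positivity),
    Real.sqrt_mul_self hc]
  congr 2
  ring

lemma sum_sqrt_pairMass_mul_sqrt_pairMass [Nonempty ι] (η : unitInterval) (v v' : ι → Bool) :
    ∑ x, √(pairMass η v x) * √(pairMass η v' x) =
      1 - hammingDist v v' * (1 - √(1 - (η : ℝ) ^ 2)) / Fintype.card ι := by
  have hcard : (Fintype.card ι : ℝ) ≠ 0 := Nat.cast_ne_zero.mpr Fintype.card_ne_zero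
  have pair_eq (j : ι) :
      √(pairMass η v (j, v j)) * √(pairMass η v' (j, v j)) +
        √(pairMass η v (j, !v j)) * √(pairMass η v' (j, !v j)) =
      1 / Fintype.card ι -
        (if v j ≠ v' j then 1 else 0) * ((1 - √(1 - (η : ℝ) ^ 2)) / Fintype.card ι) := by
    have hη0 := η.2.1
    have hη1 : 0 ≤ 1 - (η : ℝ) := sub_nonneg.mpr η.2.2
    by_cases h : v j = v' j
    · have v'_self : pairMass η v' (j, v j) = _ := h ▸ pairMass_self _ v' j
      have v'_not : pairMass η v' (j, !v j) = _ := h ▸ pairMass_not _ v' j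
      rw [v'_self, v'_not, pairMass_self, pairMass_not, Real.mul_self_sqrt (by positivity),
        Real.mul_self_sqrt (by positivity), if_neg (not_not.mpr h)]
      ring
    · have h' : v j = !v' j := Bool.eq_not.mpr h
      have v'_self : pairMass η v' (j, v j) = _ := h' ▸ pairMass_not _ v' j
      have v'_not : pairMass η v' (j, !v j) =
          (1 + η) / (2 * Fintype.card ι) := by
        rw [h', Bool.not_not, pairMass_self]
      rw [v'_self, v'_not, pairMass_self, pairMass_not, mul_comm √((1 - (η : ℝ)) / _),
        sqrt_one_add_mul_sqrt_one_sub η (by positivity), if_pos h]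
      ring
  rw [sum_prod_bool_eq_sum_self_add_not v, Finset.sum_congr rfl fun j _ => pair_eq j,
    Finset.sum_sub_distrib, ← Finset.sum_mul, ← Finset.natCast_card_filter]
  simp [hammingDist, hcard, mul_div_assoc]

variable [MeasurableSpace α]

/-- The distribution with mass `pairMass η v x` on the letter `e x`, and no mass on letters outside
the range of `e`. -/
noncomputable def pairDistr [Nonempty ι] (η : unitInterval) (e : ι × Bool ↪ α) (v : ι → Bool) :
    ProbabilityMeasure α :=
  ⟨∑ x, ENNReal.ofReal (pairMass η v x) • Measure.dirac (e x), ⟨by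
    simp [← ENNReal.ofReal_sum_of_nonneg fun x _ => pairMass_nonneg η v x, sum_pairMass]⟩⟩

lemma measureReal_pairDistr [MeasurableSingletonClass α] [Nonempty ι] (η : unitInterval)
    (e : ι × Bool ↪ α) (v : ι → Bool) (a : α) :
    (pairDistr η e v : Measure α).real {a} =
      ∑ x, ({a} : Set α).indicator (fun _ => pairMass η v x) (e x) := by
  have measure_eq : (pairDistr η e v : Measure α) {a} =
      ∑ x, ENNReal.ofReal (({a} : Set α).indicator (fun _ => pairMass η v x) (e x)) := by
    simp only [pairDistr, ProbabilityMeasure.coe_mk, Measure.coe_finsetSum, Finset.sum_apply,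
      Measure.smul_apply, Measure.dirac_apply]
    refine Finset.sum_congr rfl fun x _ => ?_
    by_cases hx : e x = a <;> simp [hx]
  rw [measureReal_def, measure_eq, ENNReal.toReal_sum fun _ _ => ENNReal.ofReal_ne_top]
  exact Finset.sum_congr rfl fun x _ => ENNReal.toReal_ofReal
    (Set.indicator_nonneg (fun _ _ => pairMass_nonneg η v x) _)

variable [MeasurableSingletonClass α] {e : ι × Bool ↪ α}

lemma measureReal_pairDistr_apply [Nonempty ι] (η : unitInterval) (v : ι → Bool) (x : ι × Bool) :
    (pairDistr η e v : Measure α).real {e x} = pairMass η v x := by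
  classical
  simp only [measureReal_pairDistr, Set.indicator_apply, Set.mem_singleton_iff, e.apply_eq_iff_eq,
    Finset.sum_ite_eq', Finset.mem_univ, if_true]

lemma measureReal_pairDistr_of_notMem_range [Nonempty ι] (η : unitInterval) (v : ι → Bool) {a : α}
    (ha : a ∉ Set.range e) : (pairDistr η e v : Measure α).real {a} = 0 := by
  rw [measureReal_pairDistr]
  exact Finset.sum_eq_zero fun x _ => by
    rw [Set.indicator_of_notMem]
    exact fun hx => ha ⟨x, hx⟩

lemma hellingerAffinity_pairDistr [Nonempty ι] [Fintype α] (η : unitInterval) (v v' : ι → Bool) :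
    hellingerAffinity (pairDistr η e v : Measure α) (pairDistr η e v') =
      1 - hammingDist v v' * (1 - √(1 - (η : ℝ) ^ 2)) / Fintype.card ι := by
  rw [← sum_sqrt_pairMass_mul_sqrt_pairMass]
  refine (Fintype.sum_of_injective e e.injective _ _ (fun a ha => ?_) fun x => ?_).symm
  · rw [measureReal_pairDistr_of_notMem_range η v ha, Real.sqrt_zero, zero_mul]
  · rw [measureReal_pairDistr_apply, measureReal_pairDistr_apply]

lemma half_sq_sub_le_of_le {x y s t : ℝ} (hxy : x ≤ y) (hts : t ≤ s) :
    (s - t) ^ 2 / 2 ≤ (x - s) ^ 2 + (y - t) ^ 2 := by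
  nlinarith [sq_nonneg (x - s + (y - t)), mul_nonneg (sub_nonneg.mpr hxy) (sub_nonneg.mpr hts)]

lemma sq_div_le_sq_sqrt_sub_sqrt (η : unitInterval) {c : ℝ} (hc : 0 ≤ c) :
    (η : ℝ) ^ 2 / c ≤ (√((1 + η) / c) - √((1 - η) / c)) ^ 2 := by
  have hη0 := η.2.1
  have hη1 : 0 ≤ 1 - (η : ℝ) := sub_nonneg.mpr η.2.2
  have sqrt_le : √(1 - (η : ℝ) ^ 2) ≤ 1 - (η : ℝ) ^ 2 / 2 :=
    Real.sqrt_le_iff.mpr ⟨by nlinarith, by nlinarith [sq_nonneg ((η : ℝ) ^ 2)]⟩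
  calc (η : ℝ) ^ 2 / c = (2 - 2 * (1 - (η : ℝ) ^ 2 / 2)) / c := by ring
    _ ≤ (2 - 2 * √(1 - (η : ℝ) ^ 2)) / c := by gcongr
    _ = (√((1 + η) / c) - √((1 - η) / c)) ^ 2 := by
        rw [sub_sq, Real.sq_sqrt (by positivity), Real.sq_sqrt (by positivity), mul_assoc,
          sqrt_one_add_mul_sqrt_one_sub η hc]
        ring

lemma hammingDist_pairDecoder_mul_le_sqHellingerDist [Nonempty ι] [Fintype α] (η : unitInterval)
    (v : ι → Bool) (q : ProbabilityMeasure α) :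
    hammingDist (pairDecoder e q) v * ((η : ℝ) ^ 2 / (4 * Fintype.card ι)) ≤
      sqHellingerDist (q : Measure α) (pairDistr η e v) := by
  have hη0 := η.2.1
  have pair_le (j : ι) :
      (if pairDecoder e q j ≠ v j then 1 else 0) * ((η : ℝ) ^ 2 / (4 * Fintype.card ι)) ≤
        (√((q : Measure α).real {e (j, v j)}) - √(pairMass η v (j, v j))) ^ 2 +
          (√((q : Measure α).real {e (j, !v j)}) - √(pairMass η v (j, !v j))) ^ 2 := by
    split_ifs with h
    · have q_le : (q : Measure α).real {e (j, v j)} ≤ (q : Measure α).real {e (j, !v j)} := by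
        revert h
        cases v j <;> simp +contextual [pairDecoder, le_of_lt]
      rw [pairMass_self, pairMass_not, one_mul]
      calc (η : ℝ) ^ 2 / (4 * Fintype.card ι) = (η : ℝ) ^ 2 / (2 * Fintype.card ι) / 2 := by
            rw [div_div]
            ring
        _ ≤ _ := by
            gcongr ?_ / 2
            exact sq_div_le_sq_sqrt_sub_sqrt η (by positivity)
        _ ≤ _ := half_sq_sub_le_of_le (Real.sqrt_le_sqrt q_le)
            (Real.sqrt_le_sqrt (by gcongr; linarith))
    · rw [zero_mul]
      positivity
  calc hammingDist (pairDecoder e q) v * ((η : ℝ) ^ 2 / (4 * Fintype.card ι))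
      ≤ ∑ x, (√((q : Measure α).real {e x}) - √(pairMass η v x)) ^ 2 := by
        rw [hammingDist, Finset.natCast_card_filter, Finset.sum_mul,
          sum_prod_bool_eq_sum_self_add_not v]
        exact Finset.sum_le_sum fun j _ => pair_le j
    _ = ∑ a ∈ Finset.univ.map e,
          (√((q : Measure α).real {a}) - √((pairDistr η e v : Measure α).real {a})) ^ 2 := by
        simp only [Finset.sum_map, measureReal_pairDistr_apply]
    _ ≤ sqHellingerDist (q : Measure α) (pairDistr η e v) :=
        Finset.sum_le_univ_sum_of_nonneg fun _ => sq_nonneg _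

end PairDistr

/-! ### The lower bound -/

section LowerBound

variable {ι : Type*} [Fintype ι] {k n : ℕ} {A : Estimator k n} {δ : ℝ}

instance Estimator.instIsMarkovKernelToKernel (A : Estimator k n) : IsMarkovKernel A.toKernel :=
  A.isMarkov

instance Estimator.instIsProbabilityMeasureOutputLaw (A : Estimator k n) (p : Distr k) :
    IsProbabilityMeasure (A.outputLaw p) := by
  unfold Estimator.outputLaw
  infer_instance

lemma hammingDist_update_not [DecidableEq ι] (v : ι → Bool) (j : ι) :
    hammingDist v (Function.update v j !v j) = 1 := by
  rw [hammingDist, Finset.card_eq_one]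
  refine ⟨j, ?_⟩
  ext i
  by_cases hij : i = j
  · subst hij
    simp
  · simp [hij]

lemma hammingDist_not (v : ι → Bool) : hammingDist v (fun j => !v j) = Fintype.card ι := by
  simp [hammingDist]

lemma Estimator.hellingerAffinity_pow_le (A : Estimator k n) (p p' : Distr k) {B : Set (Distr k)}
    (hB : MeasurableSet B) :
    (hellingerAffinity (p : Measure (Fin k)) p' ^ 2) ^ n ≤
      2 * ((A.outputLaw p).real B + (A.outputLaw p').real Bᶜ) := by
  calc (hellingerAffinity (p : Measure (Fin k)) p' ^ 2) ^ n
      = hellingerAffinity (Measure.pi fun _ : Fin n => (p : Measure (Fin k)))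
          (Measure.pi fun _ : Fin n => (p' : Measure (Fin k))) ^ 2 := by
        rw [hellingerAffinity_pi, Fintype.card_fin, pow_right_comm]
    _ ≤ 2 * ((A.outputLaw p).real B + (A.outputLaw p').real Bᶜ) :=
        hellingerAffinity_sq_le _ _ A.toKernel hB

variable {η : unitInterval} {e : ι × Bool ↪ Fin k}

lemma measurable_hammingDist_pairDecoder (v : ι → Bool) :
    Measurable fun q : Distr k => (hammingDist (pairDecoder e q) v : ℝ) :=
  (Measurable.of_discrete (f := fun u : ι → Bool => (hammingDist u v : ℝ))).comp
    measurable_pairDecoder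

lemma measurableSet_lt_hammingDist_pairDecoder (c : ℝ) (v : ι → Bool) :
    MeasurableSet {q : Distr k | c < hammingDist (pairDecoder e q) v} :=
  measurableSet_lt measurable_const (measurable_hammingDist_pairDecoder v)

variable [Nonempty ι]

lemma hammingDist_pairDecoder_le_of_klLoss_le (hη : 0 < η) {v : ι → Bool} {q : Distr k}
    (hq : klLoss q (pairDistr η e v) ≤ ENNReal.ofReal ((η : ℝ) ^ 2 / 64)) :
    (hammingDist (pairDecoder e q) v : ℝ) ≤ Fintype.card ι / 16 := by
  have hη' : (0 : ℝ) < η := hη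
  have hcard : (0 : ℝ) < Fintype.card ι := Nat.cast_pos.mpr Fintype.card_pos
  have hac : (q : Measure (Fin k)) ≪ (pairDistr η e v : Measure (Fin k)) := by
    by_contra hac
    rw [klLoss, klDiv_of_not_ac hac, top_le_iff] at hq
    exact ENNReal.ofReal_ne_top hq
  have hamming_mul_le : hammingDist (pairDecoder e q) v * ((η : ℝ) ^ 2 / (4 * Fintype.card ι)) ≤
      (η : ℝ) ^ 2 / 64 :=
    calc _ ≤ sqHellingerDist (q : Measure (Fin k)) (pairDistr η e v) :=
          hammingDist_pairDecoder_mul_le_sqHellingerDist η v q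
      _ ≤ (klLoss q (pairDistr η e v)).toReal := sqHellingerDist_le_toReal_klDiv hac
      _ ≤ (η : ℝ) ^ 2 / 64 := ENNReal.toReal_le_of_le_ofReal (by positivity) hq
  refine le_of_mul_le_mul_right (hamming_mul_le.trans_eq ?_)
    (show 0 < (η : ℝ) ^ 2 / (4 * Fintype.card ι) by positivity)
  field_simp
  norm_num

lemma Estimator.Learns.measureReal_lt_hammingDist_le (hA : A.Learns klLoss ((η : ℝ) ^ 2 / 64) δ)
    (hη : 0 < η) (hδ : 0 ≤ δ) (v : ι → Bool) :
    (A.outputLaw (pairDistr η e v)).real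
      {q | (Fintype.card ι : ℝ) / 16 < hammingDist (pairDecoder e q) v} ≤ δ := by
  refine ENNReal.toReal_le_of_le_ofReal hδ
    ((measure_mono fun q hq => ?_).trans (hA (pairDistr η e v)))
  by_contra hle
  exact (hammingDist_pairDecoder_le_of_klLoss_le hη (not_lt.mp hle)).not_gt hq

lemma Estimator.Learns.integral_hammingDist_le (hA : A.Learns klLoss ((η : ℝ) ^ 2 / 64) δ)
    (hη : 0 < η) (hδ : 0 ≤ δ) (hδ1 : δ ≤ 1 / 16) (v : ι → Bool) :
    ∫ q, (hammingDist (pairDecoder e q) v : ℝ) ∂A.outputLaw (pairDistr η e v) ≤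
      Fintype.card ι / 8 := by
  calc ∫ q, (hammingDist (pairDecoder e q) v : ℝ) ∂A.outputLaw (pairDistr η e v)
      ≤ Fintype.card ι / 16 + Fintype.card ι * (A.outputLaw (pairDistr η e v)).real
          {q | (Fintype.card ι : ℝ) / 16 < hammingDist (pairDecoder e q) v} :=
        integral_le_add_mul_measureReal_lt (measurable_hammingDist_pairDecoder v)
          (fun _ => Nat.cast_nonneg _) (fun _ => Nat.cast_le.mpr hammingDist_le_card_fintype)
          (by positivity)
    _ ≤ Fintype.card ι / 16 + Fintype.card ι * (1 / 16) := by
        gcongr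
        exact (hA.measureReal_lt_hammingDist_le hη hδ v).trans hδ1
    _ = Fintype.card ι / 8 := by ring

lemma one_sub_le_hellingerAffinity_pi_pairDistr [DecidableEq ι] (n : ℕ) (v : ι → Bool) (j : ι) :
    1 - 2 * n * ((η : ℝ) ^ 2 / Fintype.card ι) ≤
      hellingerAffinity (Measure.pi fun _ : Fin n => (pairDistr η e v : Measure (Fin k)))
        (Measure.pi fun _ : Fin n =>
          (pairDistr η e (Function.update v j !v j) : Measure (Fin k))) ^ 2 := by
  have hη1 : (η : ℝ) ^ 2 ≤ 1 := pow_le_one₀ η.2.1 η.2.2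
  have hcard : (1 : ℝ) ≤ Fintype.card ι := Nat.one_le_cast.mpr Fintype.card_pos
  have div_le_one : (η : ℝ) ^ 2 / Fintype.card ι ≤ 1 := by
    rw [div_le_one (by linarith)]
    linarith
  have sub_le_sqrt : 1 - (η : ℝ) ^ 2 ≤ √(1 - (η : ℝ) ^ 2) :=
    Real.le_sqrt_of_sq_le (by nlinarith [sq_nonneg (η : ℝ)])
  rw [hellingerAffinity_pi, hellingerAffinity_pairDistr, hammingDist_update_not, Fintype.card_fin,
    ← pow_mul, Nat.cast_one, one_mul]
  calc 1 - 2 * n * ((η : ℝ) ^ 2 / Fintype.card ι)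
      = 1 + (n * 2 : ℕ) * -((η : ℝ) ^ 2 / Fintype.card ι) := by
        push_cast
        ring
    _ ≤ (1 + -((η : ℝ) ^ 2 / Fintype.card ι)) ^ (n * 2) :=
        one_add_mul_le_pow (by linarith) _
    _ ≤ (1 - (1 - √(1 - (η : ℝ) ^ 2)) / Fintype.card ι) ^ (n * 2) := by
        rw [← sub_eq_add_neg]
        gcongr
        linarith

lemma Estimator.Learns.card_le (hA : A.Learns klLoss ((η : ℝ) ^ 2 / 64) δ) (hη : 0 < η)
    (hδ : 0 ≤ δ) (hδ1 : δ ≤ 1 / 16) (e : ι × Bool ↪ Fin k) :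
    (Fintype.card ι : ℝ) ≤ 4 * n * (η : ℝ) ^ 2 := by
  classical
  obtain ⟨v, hv⟩ := exists_card_mul_div_four_le_integral_hammingDist
    (fun v : ι → Bool => Measure.pi fun _ : Fin n => (pairDistr η e v : Measure (Fin k)))
    A.toKernel (measurable_pairDecoder (e := e))
    (one_sub_le_hellingerAffinity_pi_pairDistr n)
  have hcard : (Fintype.card ι : ℝ) ≠ 0 := Nat.cast_ne_zero.mpr Fintype.card_ne_zero
  have assouad : (Fintype.card ι : ℝ) * (1 - 2 * n * ((η : ℝ) ^ 2 / Fintype.card ι)) / 4 ≤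
      Fintype.card ι / 8 := hv.trans (hA.integral_hammingDist_le hη hδ hδ1 v)
  have : (Fintype.card ι : ℝ) * (1 - 2 * n * ((η : ℝ) ^ 2 / Fintype.card ι)) =
      Fintype.card ι - 2 * n * (η : ℝ) ^ 2 := by field_simp
  linarith

end LowerBound

section OppositeVertices

variable {ι : Type*} [Finite ι] [Nonempty ι] {k n : ℕ} {A : Estimator k n} {δ : ℝ}
  {η : unitInterval}

lemma Estimator.Learns.one_sub_sq_pow_le (hA : A.Learns klLoss ((η : ℝ) ^ 2 / 64) δ)
    (hη : 0 < η) (hδ : 0 ≤ δ) (e : ι × Bool ↪ Fin k) : (1 - (η : ℝ) ^ 2) ^ n ≤ 4 * δ := by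
  cases nonempty_fintype ι
  have hcard : (0 : ℝ) < Fintype.card ι := Nat.cast_pos.mpr Fintype.card_pos
  have hη1 : (η : ℝ) ^ 2 ≤ 1 := pow_le_one₀ η.2.1 η.2.2
  let v : ι → Bool := fun _ => true
  let v' : ι → Bool := fun j => !v j
  have affinity_sq : hellingerAffinity (pairDistr η e v : Measure (Fin k)) (pairDistr η e v') ^ 2 =
      1 - (η : ℝ) ^ 2 := by
    rw [hellingerAffinity_pairDistr, hammingDist_not, mul_div_cancel_left₀ _ hcard.ne',
      sub_sub_cancel, Real.sq_sqrt (sub_nonneg.mpr hη1)]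
  have compl_subset : {q | (Fintype.card ι : ℝ) / 16 < hammingDist (pairDecoder e q) v}ᶜ ⊆
      {q | (Fintype.card ι : ℝ) / 16 < hammingDist (pairDecoder e q) v'} := by
    intro q hq
    have triangle : (Fintype.card ι : ℝ) ≤
        hammingDist (pairDecoder e q) v + hammingDist (pairDecoder e q) v' := by
      rw [← hammingDist_not v]
      exact_mod_cast hammingDist_triangle_left v v' (pairDecoder e q)
    have : (hammingDist (pairDecoder e q) v : ℝ) ≤ Fintype.card ι / 16 := not_lt.mp hq
    change (Fintype.card ι : ℝ) / 16 < hammingDist (pairDecoder e q) v'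
    linarith
  have leCam := A.hellingerAffinity_pow_le (pairDistr η e v) (pairDistr η e v')
    (measurableSet_lt_hammingDist_pairDecoder (e := e) (Fintype.card ι / 16) v)
  rw [affinity_sq] at leCam
  linarith [hA.measureReal_lt_hammingDist_le (e := e) hη hδ v,
    (measureReal_mono compl_subset).trans (hA.measureReal_lt_hammingDist_le hη hδ v')]

lemma Estimator.Learns.log_le (hA : A.Learns klLoss ((η : ℝ) ^ 2 / 64) δ) (hη : 0 < η)
    (hη2 : (η : ℝ) ^ 2 ≤ 1 / 2) (hδ : 0 < δ) (hδ1 : δ ≤ 1 / 16) (e : ι × Bool ↪ Fin k) :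
    Real.log (1 / δ) ≤ 4 * n * (η : ℝ) ^ 2 := by
  have exp_le : Real.exp (-(2 * (η : ℝ) ^ 2)) ≤ 1 - (η : ℝ) ^ 2 := by
    rw [Real.exp_neg]
    refine inv_le_of_inv_le₀ (by linarith) (le_trans ?_ (Real.add_one_le_exp _))
    rw [inv_le_iff_one_le_mul₀ (by linarith)]
    nlinarith [sq_nonneg (η : ℝ)]
  have four_mul_le_sqrt : 4 * δ ≤ √δ := Real.le_sqrt_of_sq_le (by nlinarith)
  have exp_le_sqrt : Real.exp (n * -(2 * (η : ℝ) ^ 2)) ≤ √δ := by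
    rw [Real.exp_nat_mul]
    calc Real.exp (-(2 * (η : ℝ) ^ 2)) ^ n ≤ (1 - (η : ℝ) ^ 2) ^ n := by gcongr
      _ ≤ 4 * δ := hA.one_sub_sq_pow_le hη hδ.le e
      _ ≤ √δ := four_mul_le_sqrt
  have := (Real.le_log_iff_exp_le (Real.sqrt_pos.mpr hδ)).mpr exp_le_sqrt
  rw [Real.log_sqrt hδ.le] at this
  rw [one_div, Real.log_inv]
  linarith

end OppositeVertices

lemma Estimator.Learns.le_sampleSize {k n : ℕ} (hk : 2 ≤ k) {ε δ : ℝ} (hε : 0 < ε)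
    (hε1 : ε ≤ 1 / 128) (hδ : 0 < δ) (hδ1 : δ ≤ 1 / 16) {A : Estimator k n}
    (hA : A.Learns klLoss ε δ) : 1 / 1024 * ((k + Real.log (1 / δ)) / ε) ≤ n := by
  let η : unitInterval := ⟨√(64 * ε), Real.sqrt_nonneg _, Real.sqrt_le_one.mpr (by linarith)⟩
  have η_sq : (η : ℝ) ^ 2 = 64 * ε := Real.sq_sqrt (by positivity)
  have η_pos : 0 < η := Subtype.mk_lt_mk.mpr (Real.sqrt_pos.mpr (by positivity))
  have : Nonempty (Fin (k / 2)) := Fin.pos_iff_nonempty.mp (by omega)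
  have : Nonempty (Fin (k / 2) × Bool ↪ Fin k) :=
    Function.Embedding.nonempty_of_card_le (by simpa using Nat.div_mul_le_self k 2)
  obtain ⟨e⟩ := this
  rw [show ε = (η : ℝ) ^ 2 / 64 by rw [η_sq]; ring] at hA
  have log_le := hA.log_le η_pos (by linarith) hδ hδ1 e
  have card_le := hA.card_le η_pos hδ.le hδ1 e
  rw [η_sq] at log_le card_le
  rw [Fintype.card_fin] at card_le
  have k_le : (k : ℝ) ≤ 3 * (k / 2 : ℕ) := by
    have : k ≤ 3 * (k / 2) := by omega
    exact_mod_cast this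
  rw [mul_div_assoc', div_le_iff₀ hε]
  linarith

lemma le_sampleComplexity_klLoss {k : ℕ} (hk : 2 ≤ k) {ε δ : ℝ} (hε : 0 < ε) (hε1 : ε ≤ 1 / 128)
    (hδ : 0 < δ) (hδ1 : δ ≤ 1 / 16) :
    ENNReal.ofReal (1 / 1024 * ((k + Real.log (1 / δ)) / ε)) ≤
      ((sampleComplexity (klLoss (k := k)) ε δ : ℕ∞) : ℝ≥0∞) := by
  set x := 1 / 1024 * ((k + Real.log (1 / δ)) / ε)
  have ceil_le : ((⌈x⌉₊ : ℕ) : ℕ∞) ≤ sampleComplexity (klLoss (k := k)) ε δ :=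
    le_iInf₂ fun n ⟨_, hA⟩ =>
      Nat.cast_le.mpr (Nat.ceil_le.mpr (hA.le_sampleSize hk hε hε1 hδ hδ1))
  calc ENNReal.ofReal x ≤ ENNReal.ofReal ⌈x⌉₊ := ENNReal.ofReal_le_ofReal (Nat.le_ceil x)
    _ = ((⌈x⌉₊ : ℕ∞) : ℝ≥0∞) := by rw [ENat.toENNReal_coe, ENNReal.ofReal_natCast]
    _ ≤ ((sampleComplexity (klLoss (k := k)) ε δ : ℕ∞) : ℝ≥0∞) := ENat.toENNReal_le.mpr ceil_le

theorem mainTheorem3 :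
    ∃ c C ε₀ δ₀ : ℝ, 0 < c ∧ 0 < C ∧ 0 < ε₀ ∧ 0 < δ₀ ∧
      -- lower bound, for all estimators
      (∀ k : ℕ, 2 ≤ k → ∀ ε δ : ℝ, 0 < ε → ε ≤ ε₀ → 0 < δ → δ ≤ δ₀ →
        ENNReal.ofReal (c * ((k + Real.log (1 / δ)) / ε)) ≤
          ((sampleComplexity (klLoss (k := k)) ε δ : ℕ∞) : ℝ≥0∞)) ∧
      -- upper bound
      (∀ k : ℕ, 1 ≤ k → ∀ ε δ : ℝ, 0 < ε → ε ≤ 1 → 0 < δ → δ ≤ 1 →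
        ((sampleComplexity (klLoss (k := k)) ε δ : ℕ∞) : ℝ≥0∞) ≤
          ENNReal.ofReal (C * ((k + Real.log (1 / δ)) / ε))) ∧
      -- the upper bound is achieved by the empirical estimator
      (∀ k : ℕ, 1 ≤ k → ∀ ε δ : ℝ, 0 < ε → 0 < δ → δ ≤ 1 →
        ∀ (n : ℕ) [NeZero n], C * ((k + Real.log (1 / δ)) / ε) ≤ n →
          (empiricalEstimator k n).Learns klLoss ε δ) := by
  refine ⟨1 / 1024, 5, 1 / 128, 1 / 16, by norm_num, by norm_num, by norm_num, by norm_num,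
    fun k hk ε δ hε hε1 hδ hδ1 => le_sampleComplexity_klLoss hk hε hε1 hδ hδ1,
    fun k hk ε δ hε hε1 hδ hδ1 => sampleComplexity_klLoss_le hk hε hε1 hδ hδ1,
    fun k _ ε δ hε hδ hδ1 n _ hn => empiricalEstimator_learns_klLoss hε hδ hδ1 (le_trans ?_ hn)⟩
  have hlog : 0 ≤ Real.log (1 / δ) := Real.log_nonneg ((one_le_div hδ).mpr hδ1)
  gcongr
  norm_num
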